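/- All rings are commutative with identity and all modules are unital. An $R$-module $M$ is Gorenstein projective if it is isomorphic to the image of a differential in an exact complex $\cdots\to P_1\to P_0\to P^0\to P^1\to\cdots$ of projective $R$-modules which remains exact under $\mathrm{Hom}_R(-,Q)$ for every projective $R$-module $Q$. $\mathrm{Gpd}_R(M)\in\mathbb{N}\cup\{\infty\}$ is the least $n$ such that there is an exact sequence $0\to G_n\to\cdots\to G_0\to M\to 0$ with all $G_i$ Gorenstein projective ($\infty$ if there is none), and $G.\mathrm{gldim}(R)=\sup\{\mathrm{Gpd}_R(M)\mid M \text{ an } R\text{-module}\}$. For an $R$-module $E$, the trivial ring extension $R\ltimes E$ is the group $R\times E$ with multiplication $(r,e)(r',e')=(rr',re'+r'e)$. Let $R$ be a ring and $E$ a nonzero cyclic $R$-module such that $G.\mathrm{gldim}(R\ltimes E)<\infty$. Then $$G.\mathrm{gldim}(R\ltimes E)\le G.\mathrm{gldim}(R).$$ -/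

import Mathlib

universe u

/-- A complete projective resolution over `R`: an exact sequence
`⋯ → P i → P (i+1) → P (i+2) → ⋯` (indexed by `ℤ`) of projective `R`-modules which stays
exact after applying `Hom_R(-, Q)` for every projective `R`-module `Q`. -/
structure CompleteProjectiveResolution (R : Type u) [CommRing R] where
  P : ℤ → Type u
  [addCommGroup : ∀ i, AddCommGroup (P i)]
  [module : ∀ i, Module R (P i)]
  d : ∀ i, P i →ₗ[R] P (i + 1)
  projective : ∀ i, Module.Projective R (P i)
  exact : ∀ i, Function.Exact (d i) (d (i + 1))
  hom_exact : ∀ (Q : Type u) [AddCommGroup Q] [Module R Q] [Module.Projective R Q] (i : ℤ),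
    Function.Exact
      (fun g : P (i + 1 + 1) →ₗ[R] Q => g ∘ₗ d (i + 1))
      (fun f : P (i + 1) →ₗ[R] Q => f ∘ₗ d i)

attribute [instance] CompleteProjectiveResolution.addCommGroup
  CompleteProjectiveResolution.module

/-- `M` is Gorenstein projective: it is (isomorphic to) the image of a differential in a
complete projective resolution. -/
def IsGorensteinProjective (R : Type u) [CommRing R] (M : Type u) [AddCommGroup M]
    [Module R M] : Prop :=
  ∃ C : CompleteProjectiveResolution R, Nonempty (M ≃ₗ[R] LinearMap.range (C.d 0))

/-- `M` has a Gorenstein projective resolution of length `n`, that is, there is an exact sequence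
`0 → G_n → ⋯ → G_0 → M → 0` with all `G_i` Gorenstein projective. The sequence is given by its
first term `G_0 → M` and a resolution of length `n - 1` of the kernel of that map. -/
def HasGorensteinProjectiveResolution (R : Type u) [CommRing R] :
    ℕ → ∀ (M : Type u) [AddCommGroup M] [Module R M], Prop
  | 0, M, _, _ => IsGorensteinProjective R M
  | n + 1, M, _, _ => ∃ (G : Type u) (_ : AddCommGroup G) (_ : Module R G) (p : G →ₗ[R] M),
      IsGorensteinProjective R G ∧ Function.Surjective p ∧
        HasGorensteinProjectiveResolution R n (LinearMap.ker p)

/-- The Gorenstein projective dimension `Gpd_R(M)`: the least length of a Gorenstein projective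
resolution of `M`, and `⊤` (infinity) if there is none of finite length. -/
noncomputable def Gpd (R : Type u) [CommRing R] (M : Type u) [AddCommGroup M] [Module R M] :
    ℕ∞ :=
  ⨅ (n : ℕ) (_ : HasGorensteinProjectiveResolution R n M), (n : ℕ∞)

/-- The Gorenstein global dimension `G.gldim(R)`: the supremum of `Gpd_R(M)` over all
`R`-modules `M`. -/
noncomputable def Ggldim (R : Type u) [CommRing R] : ℕ∞ :=
  ⨆ M : ModuleCat.{u} R, Gpd R M

open CategoryTheory Abelian

/-! Write S = R ⋉ E with E = Re, and let Ext mean Ext over S into an arbitrary projective module. If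
every module has finite Gorenstein projective dimension, then Gpd M ≤ m as soon as Ext^i(M, -) = 0
for all i > m (`hasGorensteinProjectiveResolution_of_extVanishes`). So the task is to bound the
degrees in which Ext over S survives by m = G.gldim(R), which may be taken finite.

Put J = 0 ⋉ E and I = Ann(e) ⋉ 0, both ideals of S. Multiplication by (0, e) gives 0 → J ⊕ I → S → J
→ 0, so J is a direct summand of its own first syzygy. Hence Ext^i(J, -) embeds in Ext^{i+1}(J, -)
for i ≥ 1, and finiteness of G.gldim(S) kills all of these. The summand I of the syzygy then has no
higher Ext either, and 0 → I → R → J → 0 gives the same for the S-module R, hence for every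
projective R-module.

Dimension shifting over R extends this to Gorenstein projective R-modules, and then gives Ext^i = 0
for i > m on all R-modules. Finally, J² = 0, so every S-module M is an extension of M/JM by JM, both
of which are R-modules. -/

/-- The sequence `0 → M → N → P → 0` given by `f` and `g` is exact. -/
structure IsShortExact {A : Type*} [Ring A] {M N P : Type*} [AddCommGroup M] [AddCommGroup N]
    [AddCommGroup P] [Module A M] [Module A N] [Module A P]
    (f : M →ₗ[A] N) (g : N →ₗ[A] P) : Prop where
  injective : Function.Injective f
  exact : Function.Exact f g
  surjective : Function.Surjective g

/-- `Ext^i(M, Q)` vanishes for all projective modules `Q`. -/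
def ExtVanishes (A : Type u) [CommRing A] (i : ℕ) (M : ModuleCat.{u} A) : Prop :=
  ∀ Q : ModuleCat.{u} A, Module.Projective A Q → Subsingleton (Ext M Q i)

/-! ### Ext into projectives along short exact sequences -/

section

variable {A : Type u} [CommRing A]

namespace IsShortExact

variable {M N P : ModuleCat.{u} A} {f : M →ₗ[A] N} {g : N →ₗ[A] P}

/-- The short complex in the category of modules. -/
def shortComplex (h : IsShortExact f g) : ShortComplex (ModuleCat.{u} A) :=
  ShortComplex.mk (ModuleCat.ofHom f) (ModuleCat.ofHom g) (by
    ext x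
    simpa using (h.exact (f x)).2 ⟨x, rfl⟩)

lemma shortExact (h : IsShortExact f g) : h.shortComplex.ShortExact :=
  ModuleCat.shortComplex_shortExact h.shortComplex h.exact h.injective h.surjective

end IsShortExact

lemma isShortExact_ker {M N : Type*} [AddCommGroup M] [AddCommGroup N] [Module A M] [Module A N]
    {g : M →ₗ[A] N} (hg : Function.Surjective g) : IsShortExact (LinearMap.ker g).subtype g :=
  ⟨Subtype.val_injective, g.exact_subtype_ker_map, hg⟩

lemma isShortExact_mkQ {M : Type*} [AddCommGroup M] [Module A M] (N : Submodule A M) :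
    IsShortExact N.subtype N.mkQ :=
  ⟨Subtype.val_injective, LinearMap.exact_subtype_mkQ N, N.mkQ_surjective⟩

lemma extVanishes_of_projective (M : ModuleCat.{u} A) [Module.Projective A M] (i : ℕ)
    (hi : 1 ≤ i) : ExtVanishes A i M := by
  obtain ⟨i, rfl⟩ : ∃ j, i = j + 1 := ⟨i - 1, by omega⟩
  intro Q _
  have : Projective M := (IsProjective.iff_projective M).1 inferInstance
  exact Ext.subsingleton_of_projective _ _ _

lemma ExtVanishes.of_retract {i : ℕ} {M N : ModuleCat.{u} A} (h : ExtVanishes A i N)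
    (s : M →ₗ[A] N) (r : N →ₗ[A] M) (hrs : r ∘ₗ s = LinearMap.id) : ExtVanishes A i M := by
  intro Q hQ
  have := h Q hQ
  refine subsingleton_of_forall_eq 0 fun x => ?_
  have h1 : ModuleCat.ofHom s ≫ ModuleCat.ofHom r = 𝟙 M := by
    rw [← ModuleCat.ofHom_comp, hrs]; rfl
  calc x = (Ext.mk₀ (ModuleCat.ofHom s)).comp ((Ext.mk₀ (ModuleCat.ofHom r)).comp x (zero_add i))
        (zero_add i) := by
        rw [Ext.mk₀_comp_mk₀_assoc, h1, Ext.mk₀_id_comp]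
    _ = 0 := by
      rw [Subsingleton.elim ((Ext.mk₀ (ModuleCat.ofHom r)).comp x (zero_add i)) 0, Ext.comp_zero]

lemma ExtVanishes.of_equiv {i : ℕ} {M N : ModuleCat.{u} A} (h : ExtVanishes A i N)
    (e : M ≃ₗ[A] N) : ExtVanishes A i M :=
  h.of_retract e.toLinearMap e.symm.toLinearMap (by ext; simp)

section

variable {M N P : ModuleCat.{u} A} {f : M →ₗ[A] N} {g : N →ₗ[A] P}

lemma ExtVanishes.middle (h : IsShortExact f g) {i : ℕ} (hM : ExtVanishes A i M)
    (hP : ExtVanishes A i P) : ExtVanishes A i N := by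
  intro Q hQ
  have h1 : Subsingleton (Ext h.shortComplex.X₁ Q i) := hM Q hQ
  have h3 : Subsingleton (Ext h.shortComplex.X₃ Q i) := hP Q hQ
  refine subsingleton_of_forall_eq 0 fun x => ?_
  obtain ⟨y, hy⟩ := Ext.contravariant_sequence_exact₂ h.shortExact Q x (Subsingleton.elim _ _)
  rw [← hy, Subsingleton.elim y 0, Ext.comp_zero]
  rfl

lemma ExtVanishes.right (h : IsShortExact f g) {i : ℕ} (hM : ExtVanishes A i M)
    (hN : ExtVanishes A (i + 1) N) : ExtVanishes A (i + 1) P := by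
  intro Q hQ
  have h1 : Subsingleton (Ext h.shortComplex.X₁ Q i) := hM Q hQ
  have h3 : Subsingleton (Ext h.shortComplex.X₂ Q (i + 1)) := hN Q hQ
  refine subsingleton_of_forall_eq 0 fun x => ?_
  obtain ⟨y, hy⟩ := Ext.contravariant_sequence_exact₃ h.shortExact Q x (Subsingleton.elim _ _)
    (add_comm 1 i)
  rw [← hy, Subsingleton.elim y 0, Ext.comp_zero]
  rfl

lemma ExtVanishes.left (h : IsShortExact f g) {i : ℕ} (hN : ExtVanishes A i N)
    (hP : ExtVanishes A (i + 1) P) : ExtVanishes A i M := by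
  intro Q hQ
  have h1 : Subsingleton (Ext h.shortComplex.X₂ Q i) := hN Q hQ
  have h3 : Subsingleton (Ext h.shortComplex.X₃ Q (i + 1)) := hP Q hQ
  refine subsingleton_of_forall_eq 0 fun x => ?_
  obtain ⟨y, hy⟩ := Ext.contravariant_sequence_exact₁ h.shortExact Q x (add_comm 1 i)
    (Subsingleton.elim _ _)
  rw [← hy, Subsingleton.elim y 0, Ext.comp_zero]
  rfl

/-- Maps from `M` to projective modules extend along `f : M → N`. -/
def ExtendsToProjectives (f : M →ₗ[A] N) : Prop :=
  ∀ (Q : Type u) [AddCommGroup Q] [Module A Q] [Module.Projective A Q] (φ : M →ₗ[A] Q),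
    ∃ ψ : N →ₗ[A] Q, ψ ∘ₗ f = φ

lemma ExtVanishes.extendsToProjectives (h : IsShortExact f g) (hP : ExtVanishes A 1 P) :
    ExtendsToProjectives f := by
  intro Q _ _ hQ φ
  have h3 : Subsingleton (Ext h.shortComplex.X₃ (ModuleCat.of A Q) 1) := hP (ModuleCat.of A Q) hQ
  obtain ⟨y, hy⟩ := Ext.contravariant_sequence_exact₁ h.shortExact (ModuleCat.of A Q)
    (Ext.mk₀ (ModuleCat.ofHom φ)) (add_zero 1) (Subsingleton.elim _ _)
  obtain ⟨ψ, rfl⟩ := (Ext.mk₀_bijective _ _).2 y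
  rw [Ext.mk₀_comp_mk₀] at hy
  have := (Ext.mk₀_bijective _ _).1 hy
  exact ⟨ψ.hom, congrArg ModuleCat.Hom.hom this⟩

lemma ExtendsToProjectives.extVanishes (h : IsShortExact f g) (hf : ExtendsToProjectives f)
    (hN : ExtVanishes A 1 N) : ExtVanishes A 1 P := by
  intro Q hQ
  have h2 : Subsingleton (Ext h.shortComplex.X₂ Q 1) := hN Q hQ
  refine subsingleton_of_forall_eq 0 fun x => ?_
  obtain ⟨y, hy⟩ := Ext.contravariant_sequence_exact₃ h.shortExact Q x (Subsingleton.elim _ _)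
    (add_zero 1)
  obtain ⟨φ, rfl⟩ := (Ext.mk₀_bijective _ _).2 y
  obtain ⟨ψ, hψ⟩ := hf Q φ.hom
  obtain ⟨χ, rfl⟩ : ∃ χ : h.shortComplex.X₂ ⟶ Q, φ = h.shortComplex.f ≫ χ := by
    refine ⟨ModuleCat.ofHom ψ, ?_⟩
    ext x
    exact (LinearMap.congr_fun hψ x).symm
  -- The class is the extension class composed with a map that factors through `f`, and that
  -- composite is zero.
  rw [← hy, ← Ext.mk₀_comp_mk₀, ← Ext.comp_assoc _ _ _ (add_zero 1) (zero_add 0) (by simp),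
    h.shortExact.extClass_comp, Ext.zero_comp]
  rfl

end

lemma exists_projective_cover (M : ModuleCat.{u} A) :
    ∃ (P : ModuleCat.{u} A) (g : P →ₗ[A] M), Module.Projective A P ∧ Function.Surjective g :=
  ⟨ModuleCat.of A (M →₀ A), Finsupp.linearCombination A id,
    inferInstanceAs (Module.Projective A (M →₀ A)),
    Finsupp.linearCombination_id_surjective A M⟩

end

/-! ### Complete resolutions assembled from short exact sequences -/

lemma exists_int_chain {α : Type*} (r : α → α → Prop) (hr : ∀ x, ∃ y, r x y)
    (hl : ∀ y, ∃ x, r x y) (a : α) :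
    ∃ X : ℤ → α, X 1 = a ∧ ∀ i, r (X i) (X (i + 1)) := by
  choose next hnext using hr
  choose prev hprev using hl
  let Y : ℤ → α := fun i => Int.rec (fun n => next^[n] a) (fun n => prev^[n + 1] a) i
  have hY : ∀ i, r (Y i) (Y (i + 1)) := by
    intro i
    rcases i with n | n
    · have h1 : Y (Int.ofNat n + 1) = next (Y (Int.ofNat n)) :=
        Function.iterate_succ_apply' next n a
      rw [h1]
      exact hnext _
    · have h1 : Y (Int.negSucc n) = prev (Y (Int.negSucc n + 1)) := by
        have h2 : Y (Int.negSucc n + 1) = prev^[n] a := by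
          cases n <;> rfl
        rw [h2]
        exact Function.iterate_succ_apply' prev n a
      rw [h1]
      exact hprev _
  -- The shift puts the given object at index 1, because the differential `d 0` of the assembled
  -- complex has image `X 1`.
  refine ⟨fun i => Y (i - 1), rfl, fun i => ?_⟩
  have := hY (i - 1)
  rwa [show i - 1 + 1 = i + 1 - 1 by ring] at this

section

variable {A : Type u} [CommRing A]

lemma exists_comp_eq_of_ker_le {M N Q : Type*} [AddCommGroup M] [AddCommGroup N] [AddCommGroup Q]
    [Module A M] [Module A N] [Module A Q] {g : M →ₗ[A] N} (hg : Function.Surjective g)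
    (φ : M →ₗ[A] Q) (h : LinearMap.ker g ≤ LinearMap.ker φ) : ∃ χ : N →ₗ[A] Q, χ ∘ₗ g = φ := by
  refine ⟨(LinearMap.ker g).liftQ φ h ∘ₗ (g.quotKerEquivOfSurjective hg).symm.toLinearMap, ?_⟩
  ext y
  have : (g.quotKerEquivOfSurjective hg).symm (g y) = (LinearMap.ker g).mkQ y := by
    rw [LinearEquiv.symm_apply_eq]; rfl
  simp [this]

/-- There is a short exact sequence `0 → M → P → N → 0` with `P` projective which stays exact
under homomorphisms into projective modules. -/
def ProjectiveStep (M N : ModuleCat.{u} A) : Prop :=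
  ∃ (P : ModuleCat.{u} A) (f : M →ₗ[A] P) (g : P →ₗ[A] N),
    Module.Projective A P ∧ IsShortExact f g ∧ ExtendsToProjectives f

/-- Splicing the sequences 0 → X i → P i → X (i+1) → 0 gives the complex, with differential P i → X
(i+1) → P (i+1). Extension of maps along each `f i` is what keeps it exact under Hom into
projectives. -/
lemma isGorensteinProjective_of_chain (X : ℤ → ModuleCat.{u} A)
    (hX : ∀ i, ProjectiveStep (X i) (X (i + 1))) : IsGorensteinProjective A (X 1) := by
  choose P f g hP hfg hext using hX
  have hgf : ∀ i x, g i (f i x) = 0 := fun i x => ((hfg i).exact _).2 ⟨x, rfl⟩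
  let C : CompleteProjectiveResolution A :=
    { P := fun i => P i
      d := fun i => f (i + 1) ∘ₗ g i
      projective := hP
      exact := by
        intro i y
        constructor
        · intro hy
          have hy' : g (i + 1) y = 0 :=
            (hfg (i + 1 + 1)).injective ((show f (i + 1 + 1) (g (i + 1) y) = 0 from hy).trans
              (map_zero _).symm)
          obtain ⟨z, rfl⟩ := ((hfg (i + 1)).exact y).1 hy'
          obtain ⟨w, rfl⟩ := (hfg i).surjective z
          exact ⟨w, rfl⟩
        · rintro ⟨w, rfl⟩
          simp [hgf]
      hom_exact := by
        intro Q _ _ _ i φ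
        constructor
        · intro hφ
          have h1 : ∀ z, φ (f (i + 1) z) = 0 := by
            intro z
            obtain ⟨w, rfl⟩ := (hfg i).surjective z
            exact LinearMap.congr_fun hφ w
          obtain ⟨χ, hχ⟩ := exists_comp_eq_of_ker_le (hfg (i + 1)).surjective φ (by
            intro y hy
            obtain ⟨z, rfl⟩ := ((hfg (i + 1)).exact y).1 hy
            exact h1 z)
          obtain ⟨ψ, hψ⟩ := hext (i + 1 + 1) Q χ
          refine ⟨ψ, ?_⟩
          change ψ ∘ₗ (f (i + 1 + 1) ∘ₗ g (i + 1)) = φ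
          rw [← LinearMap.comp_assoc, hψ, hχ]
        · rintro ⟨ψ, rfl⟩
          ext w
          simp [hgf] }
  refine ⟨C, ⟨(LinearEquiv.ofInjective (f 1) (hfg 1).injective).trans (LinearEquiv.ofEq _ _ ?_)⟩⟩
  change LinearMap.range (f (0 + 1)) = LinearMap.range (f (0 + 1) ∘ₗ g 0)
  rw [LinearMap.range_comp, LinearMap.range_eq_top.2 (hfg 0).surjective, Submodule.map_top]

/-- Coinduction principle for Gorenstein projective modules. -/
lemma isGorensteinProjective_of_class (p : ModuleCat.{u} A → Prop)
    (hr : ∀ M, p M → ∃ N, p N ∧ ProjectiveStep M N)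
    (hl : ∀ M, p M → ∃ N, p N ∧ ProjectiveStep N M) (M : ModuleCat.{u} A) (hM : p M) :
    IsGorensteinProjective A M := by
  obtain ⟨X, hX1, hX⟩ := exists_int_chain
    (fun M N : {M : ModuleCat.{u} A // p M} => ProjectiveStep M.1 N.1)
    (fun M => by obtain ⟨N, hN, h⟩ := hr M.1 M.2; exact ⟨⟨N, hN⟩, h⟩)
    (fun M => by obtain ⟨N, hN, h⟩ := hl M.1 M.2; exact ⟨⟨N, hN⟩, h⟩) ⟨M, hM⟩
  have := isGorensteinProjective_of_chain (fun i => (X i).1) hX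
  change IsGorensteinProjective A (X 1).1 at this
  rwa [hX1] at this

namespace CompleteProjectiveResolution

variable (C : CompleteProjectiveResolution A)

/-- Pulled back along `d j`, the map becomes a cocycle of the Hom complex, and exactness there
supplies the extension. -/
lemma extendsToProjectives_range_subtype (j : ℤ) (Q : Type u) [AddCommGroup Q] [Module A Q]
    [Module.Projective A Q] (φ : LinearMap.range (C.d j) →ₗ[A] Q) :
    ∃ ψ : C.P (j + 1) →ₗ[A] Q, ψ ∘ₗ (LinearMap.range (C.d j)).subtype = φ := by
  obtain ⟨k, rfl⟩ : ∃ k, j = k + 1 := ⟨j - 1, by ring⟩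
  obtain ⟨ψ, hψ⟩ := (C.hom_exact Q k (φ ∘ₗ (C.d (k + 1)).rangeRestrict)).1 (by
    ext x
    have : (C.d (k + 1)).rangeRestrict (C.d k x) = 0 := by
      ext
      exact (C.exact k _).2 ⟨x, rfl⟩
    simp [this])
  refine ⟨ψ, ?_⟩
  ext ⟨_, y, rfl⟩
  exact LinearMap.congr_fun hψ y

lemma projectiveStep (M N : ModuleCat.{u} A) (j : ℤ) (e : M ≃ₗ[A] LinearMap.range (C.d j))
    (e' : N ≃ₗ[A] LinearMap.range (C.d (j + 1))) : ProjectiveStep M N := by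
  refine ⟨ModuleCat.of A (C.P (j + 1)), (LinearMap.range (C.d j)).subtype ∘ₗ e.toLinearMap,
    e'.symm.toLinearMap ∘ₗ (C.d (j + 1)).rangeRestrict, C.projective (j + 1), ⟨?_, ?_, ?_⟩, ?_⟩
  · exact Subtype.val_injective.comp e.injective
  · intro y
    have h1 : (e'.symm.toLinearMap ∘ₗ (C.d (j + 1)).rangeRestrict) y = 0 ↔ C.d (j + 1) y = 0 := by
      change e'.symm _ = 0 ↔ _
      rw [LinearEquiv.map_eq_zero_iff, Subtype.ext_iff]
      rfl
    rw [h1, C.exact j y]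
    constructor
    · rintro ⟨x, rfl⟩
      exact ⟨e.symm ⟨_, x, rfl⟩, by simp⟩
    · rintro ⟨x, rfl⟩
      exact (e x).2
  · exact e'.symm.surjective.comp (C.d (j + 1)).surjective_rangeRestrict
  · intro Q _ _ _ φ
    obtain ⟨ψ, hψ⟩ := C.extendsToProjectives_range_subtype j Q (φ ∘ₗ e.symm.toLinearMap)
    refine ⟨ψ, ?_⟩
    rw [← LinearMap.comp_assoc, hψ]
    ext x
    simp

lemma isGorensteinProjective (j : ℤ) (M : ModuleCat.{u} A)
    (e : M ≃ₗ[A] LinearMap.range (C.d j)) : IsGorensteinProjective A M := by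
  refine isGorensteinProjective_of_class
    (fun M => ∃ j, Nonempty (M ≃ₗ[A] LinearMap.range (C.d j))) ?_ ?_ M ⟨j, ⟨e⟩⟩
  · rintro M ⟨j, ⟨e⟩⟩
    exact ⟨ModuleCat.of A (LinearMap.range (C.d (j + 1))), ⟨j + 1, ⟨LinearEquiv.refl _ _⟩⟩,
      C.projectiveStep _ _ j e (LinearEquiv.refl _ _)⟩
  · rintro M ⟨j, ⟨e⟩⟩
    obtain ⟨k, rfl⟩ : ∃ k, j = k + 1 := ⟨j - 1, by ring⟩
    exact ⟨ModuleCat.of A (LinearMap.range (C.d k)), ⟨k, ⟨LinearEquiv.refl _ _⟩⟩,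
      C.projectiveStep _ _ k (LinearEquiv.refl _ _) e⟩

end CompleteProjectiveResolution

namespace IsGorensteinProjective

lemma exists_step_right {M : ModuleCat.{u} A} (hM : IsGorensteinProjective A M) :
    ∃ N : ModuleCat.{u} A, IsGorensteinProjective A N ∧ ProjectiveStep M N := by
  obtain ⟨C, ⟨e⟩⟩ := hM
  exact ⟨ModuleCat.of A (LinearMap.range (C.d (0 + 1))),
    C.isGorensteinProjective (0 + 1) _ (LinearEquiv.refl _ _),
    C.projectiveStep _ _ 0 e (LinearEquiv.refl _ _)⟩

lemma exists_step_left {M : ModuleCat.{u} A} (hM : IsGorensteinProjective A M) :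
    ∃ N : ModuleCat.{u} A, IsGorensteinProjective A N ∧ ProjectiveStep N M := by
  obtain ⟨C, ⟨e⟩⟩ := hM
  obtain ⟨k, hk⟩ : ∃ k : ℤ, 0 = k + 1 := ⟨-1, by ring⟩
  rw [hk] at e
  exact ⟨ModuleCat.of A (LinearMap.range (C.d k)),
    C.isGorensteinProjective k _ (LinearEquiv.refl _ _),
    C.projectiveStep _ _ k (LinearEquiv.refl _ _) e⟩

lemma extVanishes {M : ModuleCat.{u} A} (hM : IsGorensteinProjective A M) (i : ℕ) (hi : 1 ≤ i) :
    ExtVanishes A i M := by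
  induction i, hi using Nat.le_induction generalizing M with
  | base =>
    obtain ⟨N, hN, P, f, g, hP, hfg, hf⟩ := hM.exists_step_left
    exact hf.extVanishes hfg (extVanishes_of_projective P 1 le_rfl)
  | succ i hi ih =>
    obtain ⟨N, hN, P, f, g, hP, hfg, hf⟩ := hM.exists_step_left
    exact (ih hN).right hfg (extVanishes_of_projective P (i + 1) (by omega))

end IsGorensteinProjective

/-- Modules obtained from those satisfying `p` by finitely many syzygies. -/
inductive IsSyzygyOf (p : ModuleCat.{u} A → Prop) : ModuleCat.{u} A → Prop
  | of (M : ModuleCat.{u} A) : p M → IsSyzygyOf p M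
  | step {M N : ModuleCat.{u} A} : IsSyzygyOf p N → ProjectiveStep M N → IsSyzygyOf p M

/-- Only the right half of a complete resolution has to be constructed: projective covers provide
the left half, and Ext vanishing passes to syzygies. Closing `p` under syzygies makes the
coinduction principle applicable. -/
lemma isGorensteinProjective_of_coresolutions (p : ModuleCat.{u} A → Prop)
    (hp : ∀ M, p M → ∀ i, 1 ≤ i → ExtVanishes A i M)
    (hr : ∀ M, p M → ∃ (N P : ModuleCat.{u} A) (f : M →ₗ[A] P) (g : P →ₗ[A] N),
      p N ∧ Module.Projective A P ∧ IsShortExact f g)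
    (M : ModuleCat.{u} A) (hM : p M) : IsGorensteinProjective A M := by
  have hp' : ∀ M, IsSyzygyOf p M → ∀ i, 1 ≤ i → ExtVanishes A i M := by
    intro M hM
    induction hM with
    | of M hM => exact hp M hM
    | step hN h ih =>
      intro i hi
      obtain ⟨P, f, g, hP, hfg, hf⟩ := h
      exact (extVanishes_of_projective P i hi).left hfg (ih (i + 1) (by omega))
  refine isGorensteinProjective_of_class (IsSyzygyOf p) ?_ ?_ M (.of M hM)
  · intro M hM
    cases hM with
    | of M hM =>
      obtain ⟨N, P, f, g, hN, hP, hfg⟩ := hr M hM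
      exact ⟨N, .of N hN, P, f, g, hP, hfg, (hp N hN 1 le_rfl).extendsToProjectives hfg⟩
    | step hN h => exact ⟨_, hN, h⟩
  · intro M hM
    obtain ⟨P, g, hP, hg⟩ := exists_projective_cover M
    have h : ProjectiveStep (ModuleCat.of A (LinearMap.ker g)) M :=
      ⟨P, _, g, hP, isShortExact_ker hg,
        (hp' M hM 1 le_rfl).extendsToProjectives (isShortExact_ker hg)⟩
    exact ⟨_, .step hM h, h⟩

end

/-! ### Gorenstein projective dimension detected by Ext -/

section

variable {A : Type u} [CommRing A]

lemma IsShortExact.exists_pushout {M G N W X : ModuleCat.{u} A} {f : M →ₗ[A] G} {g : G →ₗ[A] N}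
    {f' : M →ₗ[A] W} {g' : W →ₗ[A] X} (h : IsShortExact f g) (h' : IsShortExact f' g') :
    ∃ (U : ModuleCat.{u} A) (a : W →ₗ[A] U) (b : U →ₗ[A] N) (c : G →ₗ[A] U) (d : U →ₗ[A] X),
      IsShortExact a b ∧ IsShortExact c d := by
  let K : Submodule A (G × W) := LinearMap.range (f.prod (-f'))
  have hK : ∀ x y, (x, y) ∈ K ↔ ∃ m, f m = x ∧ -f' m = y := by
    intro x y
    simp [K]
  have hgf : ∀ m, g (f m) = 0 := fun m => (h.exact _).2 ⟨m, rfl⟩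
  have hgf' : ∀ m, g' (f' m) = 0 := fun m => (h'.exact _).2 ⟨m, rfl⟩
  refine ⟨ModuleCat.of A ((G × W) ⧸ K), K.mkQ ∘ₗ LinearMap.inr A G W,
    K.liftQ (g ∘ₗ LinearMap.fst A G W) ?_, K.mkQ ∘ₗ LinearMap.inl A G W,
    K.liftQ (g' ∘ₗ LinearMap.snd A G W) ?_, ⟨?_, ?_, ?_⟩, ⟨?_, ?_, ?_⟩⟩
  · rintro _ ⟨m, rfl⟩
    simp [hgf]
  · rintro _ ⟨m, rfl⟩
    simp [hgf']
  · refine (injective_iff_map_eq_zero _).2 fun y hy => ?_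
    obtain ⟨m, hm, rfl⟩ := (hK 0 y).1 ((Submodule.Quotient.mk_eq_zero K).1 hy)
    rw [h.injective (hm.trans (map_zero f).symm)]
    simp
  · intro z
    obtain ⟨⟨x, y⟩, rfl⟩ := K.mkQ_surjective z
    constructor
    · intro hz
      obtain ⟨m, rfl⟩ := (h.exact x).1 hz
      refine ⟨y + f' m, (Submodule.Quotient.eq K).2 ((hK _ _).2 ⟨-m, ?_, ?_⟩)⟩ <;> simp
    · rintro ⟨w, hw⟩
      rw [← hw]
      change g 0 = 0
      exact map_zero g
  · intro n
    obtain ⟨x, rfl⟩ := h.surjective n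
    exact ⟨K.mkQ (x, 0), rfl⟩
  · refine (injective_iff_map_eq_zero _).2 fun x hx => ?_
    obtain ⟨m, rfl, hm⟩ := (hK x 0).1 ((Submodule.Quotient.mk_eq_zero K).1 hx)
    rw [h'.injective ((neg_eq_zero.1 hm).trans (map_zero f').symm)]
    simp
  · intro z
    obtain ⟨⟨x, y⟩, rfl⟩ := K.mkQ_surjective z
    constructor
    · intro hz
      obtain ⟨m, rfl⟩ := (h'.exact y).1 hz
      refine ⟨x + f m, (Submodule.Quotient.eq K).2 ((hK _ _).2 ⟨m, ?_, ?_⟩)⟩ <;> simp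
    · rintro ⟨w, hw⟩
      rw [← hw]
      change g' 0 = 0
      exact map_zero g'
  · intro n
    obtain ⟨y, rfl⟩ := h'.surjective n
    exact ⟨K.mkQ (0, y), rfl⟩

lemma IsShortExact.exists_quotient {W U M P Y : ModuleCat.{u} A} {a : W →ₗ[A] U} {b : U →ₗ[A] M}
    {s : U →ₗ[A] P} {t : P →ₗ[A] Y} (h : IsShortExact a b) (h' : IsShortExact s t) :
    ∃ (V : ModuleCat.{u} A) (q : P →ₗ[A] V) (c : M →ₗ[A] V) (d : V →ₗ[A] Y),
      IsShortExact (s ∘ₗ a) q ∧ IsShortExact c d := by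
  have hba : ∀ m, b (a m) = 0 := fun m => (h.exact _).2 ⟨m, rfl⟩
  have hts : ∀ m, t (s m) = 0 := fun m => (h'.exact _).2 ⟨m, rfl⟩
  let K : Submodule A P := LinearMap.range (s ∘ₗ a)
  obtain ⟨c, hc⟩ := exists_comp_eq_of_ker_le h.surjective (K.mkQ ∘ₗ s) (by
    intro x hx
    obtain ⟨w, rfl⟩ := (h.exact x).1 hx
    exact (Submodule.Quotient.mk_eq_zero K).2 ⟨w, rfl⟩)
  have hc' : ∀ x, c (b x) = K.mkQ (s x) := fun x => LinearMap.congr_fun hc x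
  refine ⟨ModuleCat.of A (P ⧸ K), K.mkQ, c, K.liftQ t ?_, ⟨?_, ?_, K.mkQ_surjective⟩,
    ⟨?_, ?_, ?_⟩⟩
  · rintro _ ⟨w, rfl⟩
    exact hts _
  · exact h'.injective.comp h.injective
  · exact (s ∘ₗ a).exact_map_mkQ_range
  · refine (injective_iff_map_eq_zero _).2 fun m hm => ?_
    obtain ⟨x, rfl⟩ := h.surjective m
    rw [hc'] at hm
    obtain ⟨w, hw⟩ := (Submodule.Quotient.mk_eq_zero K).1 hm
    rw [← h'.injective hw, hba]
  · intro z
    obtain ⟨p, rfl⟩ := K.mkQ_surjective z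
    constructor
    · intro hp
      obtain ⟨x, rfl⟩ := (h'.exact p).1 hp
      exact ⟨b x, hc' x⟩
    · rintro ⟨m, hm⟩
      obtain ⟨x, rfl⟩ := h.surjective m
      rw [← hm, hc']
      exact hts x
  · intro y
    obtain ⟨p, rfl⟩ := h'.surjective y
    exact ⟨K.mkQ p, rfl⟩

lemma IsShortExact.nonempty_equiv_prod {M N P : ModuleCat.{u} A} {f : M →ₗ[A] N} {g : N →ₗ[A] P}
    (h : IsShortExact f g) (hM : Module.Projective A M) (hf : ExtendsToProjectives f) :
    Nonempty (N ≃ₗ[A] M × P) := by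
  obtain ⟨r, hr⟩ := hf M LinearMap.id
  have hr' : ∀ x, r (f x) = x := fun x => LinearMap.congr_fun hr x
  refine ⟨LinearEquiv.ofBijective (r.prod g) ⟨?_, ?_⟩⟩
  · refine (injective_iff_map_eq_zero _).2 fun x hx => ?_
    obtain ⟨h1, h2⟩ := Prod.mk.inj hx
    obtain ⟨m, rfl⟩ := (h.exact x).1 h2
    change r (f m) = 0 at h1
    rw [← hr' m, h1, map_zero]
  · rintro ⟨m, p⟩
    obtain ⟨x, rfl⟩ := h.surjective p
    refine ⟨x + f (m - r x), Prod.ext ?_ ?_⟩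
    · change r (x + f (m - r x)) = m
      rw [map_add, hr']; abel
    · change g (x + f (m - r x)) = g x
      rw [map_add, (h.exact _).2 ⟨_, rfl⟩, add_zero]

/-- A horseshoe argument: push out along M → Q. The result is an extension of P by the projective Q,
so it splits and embeds in Q × Q'. The cokernel of N → Q × Q' is again an extension of Gorenstein
projectives. -/
lemma IsGorensteinProjective.of_isShortExact {M N P : ModuleCat.{u} A} {f : M →ₗ[A] N}
    {g : N →ₗ[A] P} (h : IsShortExact f g) (hM : IsGorensteinProjective A M)
    (hP : IsGorensteinProjective A P) : IsGorensteinProjective A N := by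
  refine isGorensteinProjective_of_coresolutions
    (fun N => ∃ (M P : ModuleCat.{u} A) (f : M →ₗ[A] N) (g : N →ₗ[A] P), IsShortExact f g ∧
      IsGorensteinProjective A M ∧ IsGorensteinProjective A P) ?_ ?_ N ⟨M, P, f, g, h, hM, hP⟩
  · rintro N ⟨M, P, f, g, h, hM, hP⟩ i hi
    exact (hM.extVanishes i hi).middle h (hP.extVanishes i hi)
  · rintro N ⟨M, P, f, g, h, hM, hP⟩
    obtain ⟨M₁, hM₁, Q, s, t, hQ, hst, -⟩ := hM.exists_step_right
    obtain ⟨P₁, hP₁, Q', s', t', hQ', hst', -⟩ := hP.exists_step_right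
    obtain ⟨U, a, b, c, d, hab, hcd⟩ := h.exists_pushout hst
    obtain ⟨e⟩ := hab.nonempty_equiv_prod hQ ((hP.extVanishes 1 le_rfl).extendsToProjectives hab)
    have h1 : IsShortExact ((LinearMap.prodMap LinearMap.id s') ∘ₗ e.toLinearMap)
        (t' ∘ₗ LinearMap.snd A Q Q') := by
      refine ⟨?_, ?_, hst'.surjective.comp Prod.snd_surjective⟩
      · exact (Function.injective_id.prodMap hst'.injective).comp e.injective
      · rintro ⟨x, y⟩
        constructor
        · intro hy
          obtain ⟨z, rfl⟩ := (hst'.exact y).1 hy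
          exact ⟨e.symm (x, z), by simp⟩
        · rintro ⟨z, hz⟩
          obtain ⟨-, rfl⟩ := Prod.mk.inj hz
          exact (hst'.exact _).2 ⟨_, rfl⟩
    obtain ⟨V, q, c', d', h2, h3⟩ := IsShortExact.exists_quotient
      (P := ModuleCat.of A (Q × Q')) hcd h1
    exact ⟨V, ModuleCat.of A (Q × Q'), _, q, ⟨M₁, P₁, c', d', h3, hM₁, hP₁⟩,
      inferInstanceAs (Module.Projective A (Q × Q')), h2⟩

lemma isGorensteinProjective_of_projective (M : ModuleCat.{u} A) [Module.Projective A M] :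
    IsGorensteinProjective A M := by
  refine isGorensteinProjective_of_coresolutions (fun M => Module.Projective A M)
    (fun M hM i hi => extVanishes_of_projective M i hi) (fun M hM => ?_) M inferInstance
  exact ⟨ModuleCat.of A PUnit, M, LinearMap.id, 0,
    inferInstanceAs (Module.Projective A PUnit.{u + 1}), hM,
    Function.injective_id, fun x => ⟨fun _ => ⟨x, rfl⟩, fun _ => rfl⟩, fun _ => ⟨0, rfl⟩⟩

/-- Modules with a finite resolution by projective modules. -/
inductive HasFiniteProjectiveResolution : ModuleCat.{u} A → Prop
  | of (M : ModuleCat.{u} A) : Module.Projective A M → HasFiniteProjectiveResolution M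
  | step {K P M : ModuleCat.{u} A} (f : K →ₗ[A] P) (g : P →ₗ[A] M) :
      HasFiniteProjectiveResolution K → Module.Projective A P → IsShortExact f g →
      HasFiniteProjectiveResolution M

/-- The vanishing passes to the syzygy, which is projective by induction; the sequence then splits.
-/
lemma HasFiniteProjectiveResolution.projective {M : ModuleCat.{u} A}
    (hM : HasFiniteProjectiveResolution M) (h : ∀ i, 1 ≤ i → ExtVanishes A i M) :
    Module.Projective A M := by
  induction hM with
  | of M hM => exact hM
  | @step K P M f g hK hP hfg ih =>
    have hK' := ih fun i hi =>
      (extVanishes_of_projective P i hi).left hfg (h (i + 1) (by omega))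
    obtain ⟨e⟩ := hfg.nonempty_equiv_prod hK' ((h 1 le_rfl).extendsToProjectives hfg)
    refine Module.Projective.of_split (M := P) (e.symm.toLinearMap ∘ₗ LinearMap.inr A K M)
      (LinearMap.snd A K M ∘ₗ e.toLinearMap) ?_
    ext x
    simp

lemma exists_finiteProjectiveResolution_extension (n : ℕ) (M : ModuleCat.{u} A)
    (hM : HasGorensteinProjectiveResolution A n M) :
    ∃ (W X : ModuleCat.{u} A) (f : M →ₗ[A] W) (g : W →ₗ[A] X), IsShortExact f g ∧
      HasFiniteProjectiveResolution W ∧ IsGorensteinProjective A X := by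
  induction n generalizing M with
  | zero =>
    obtain ⟨N, hN, P, f, g, hP, hfg, -⟩ := IsGorensteinProjective.exists_step_right (M := M) hM
    exact ⟨P, N, f, g, hfg, .of P hP, hN⟩
  | succ n ih =>
    obtain ⟨G, _, _, p, hG, hp, hK⟩ := hM
    obtain ⟨W, X, f, g, hfg, hW, hX⟩ := ih (ModuleCat.of A (LinearMap.ker p)) hK
    obtain ⟨U, a, b, c, d, hab, hcd⟩ := IsShortExact.exists_pushout (G := ModuleCat.of A G)
      (isShortExact_ker hp) hfg
    have hU : IsGorensteinProjective A U := .of_isShortExact hcd hG hX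
    -- Here 0 → W → U → M → 0 with U Gorenstein projective. Embedding U in a projective P, the
    -- quotient V = P/W contains M with cokernel Y.
    obtain ⟨Y, hY, P, s, t, hP, hst, -⟩ := hU.exists_step_right
    obtain ⟨V, q, c', d', h1, h2⟩ := hab.exists_quotient hst
    exact ⟨V, Y, c', d', h2, .step _ q hW hP h1, hY⟩

/-- In 0 → M → W → X → 0 with W of finite projective dimension and X Gorenstein projective, W
inherits the vanishing and is therefore projective. This starts the coresolution, and X continues
it. -/
lemma isGorensteinProjective_of_extVanishes {n : ℕ} {M : ModuleCat.{u} A}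
    (hM : HasGorensteinProjectiveResolution A n M) (h : ∀ i, 1 ≤ i → ExtVanishes A i M) :
    IsGorensteinProjective A M := by
  refine isGorensteinProjective_of_coresolutions
    (fun N => (∀ i, 1 ≤ i → ExtVanishes A i N) ∧ ∃ n, HasGorensteinProjectiveResolution A n N)
    (fun N hN => hN.1) ?_ M ⟨h, n, hM⟩
  rintro M ⟨h, n, hM⟩
  obtain ⟨W, X, f, g, hfg, hW, hX⟩ := exists_finiteProjectiveResolution_extension n M hM
  exact ⟨X, W, f, g, ⟨hX.extVanishes, 0, hX⟩,
    hW.projective fun i hi => (h i hi).middle hfg (hX.extVanishes i hi), hfg⟩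

lemma extVanishes_of_hasGorensteinProjectiveResolution (n : ℕ) (M : ModuleCat.{u} A)
    (hM : HasGorensteinProjectiveResolution A n M) (i : ℕ) (hi : n < i) : ExtVanishes A i M := by
  induction n generalizing M i with
  | zero => exact IsGorensteinProjective.extVanishes (M := M) hM i hi
  | succ n ih =>
    obtain ⟨G, _, _, p, hG, hp, hK⟩ := hM
    obtain ⟨i, rfl⟩ : ∃ j, i = j + 1 := ⟨i - 1, by omega⟩
    exact (ih (ModuleCat.of A (LinearMap.ker p)) hK i (by omega)).right (N := ModuleCat.of A G)
      (isShortExact_ker hp) (IsGorensteinProjective.extVanishes (M := ModuleCat.of A G) hG _ (by omega))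

lemma hasGorensteinProjectiveResolution_of_extVanishes
    (hA : ∀ M : ModuleCat.{u} A, ∃ n, HasGorensteinProjectiveResolution A n M) (m : ℕ)
    (M : ModuleCat.{u} A) (h : ∀ i, m < i → ExtVanishes A i M) :
    HasGorensteinProjectiveResolution A m M := by
  induction m generalizing M with
  | zero =>
    obtain ⟨n, hn⟩ := hA M
    exact isGorensteinProjective_of_extVanishes hn h
  | succ m ih =>
    obtain ⟨P, g, hP, hg⟩ := exists_projective_cover M
    refine ⟨P, _, _, g, isGorensteinProjective_of_projective P, hg,
      ih (ModuleCat.of A (LinearMap.ker g)) fun i hi => ?_⟩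
    exact (extVanishes_of_projective P i (by omega)).left (isShortExact_ker hg)
      (h (i + 1) (by omega))

end

/-! ### Modules that are summands of their own syzygy -/

section

variable {A : Type u} [CommRing A]

lemma exists_hasGorensteinProjectiveResolution_of_Ggldim_le {m : ℕ} (h : Ggldim A ≤ m)
    (M : ModuleCat.{u} A) : ∃ n ≤ m, HasGorensteinProjectiveResolution A n M := by
  have h1 : Gpd A M < (m : ℕ∞) + 1 :=
    ((le_iSup (fun M : ModuleCat.{u} A => Gpd A M) M).trans h).trans_lt
      (ENat.lt_add_one_iff (ENat.natCast_ne_top m) |>.2 le_rfl)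
  obtain ⟨n, hn⟩ := iInf_lt_iff.1 h1
  obtain ⟨hM, hn⟩ := iInf_lt_iff.1 hn
  refine ⟨n, ?_, hM⟩
  have : n < m + 1 := by exact_mod_cast hn
  omega

lemma IsShortExact.finsupp {M N P : Type*} [AddCommGroup M] [AddCommGroup N] [AddCommGroup P]
    [Module A M] [Module A N] [Module A P] {f : M →ₗ[A] N} {g : N →ₗ[A] P}
    (h : IsShortExact f g) (X : Type*) :
    IsShortExact (Finsupp.mapRange.linearMap (α := X) f)
      (Finsupp.mapRange.linearMap (α := X) g) := by
  refine ⟨Finsupp.mapRange_injective f (map_zero f) h.injective, fun v => ?_,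
    Finsupp.mapRange_surjective g (map_zero g) h.surjective⟩
  constructor
  · intro hv
    have hinv := Function.leftInverse_invFun h.injective
    refine ⟨v.mapRange (Function.invFun f) ((congrArg _ (map_zero f).symm).trans (hinv 0)), ?_⟩
    ext x
    obtain ⟨m, hm⟩ := (h.exact (v x)).1 (DFunLike.congr_fun hv x)
    simp [← hm, hinv m]
  · rintro ⟨w, rfl⟩
    ext x
    exact (h.exact _).2 ⟨_, rfl⟩

lemma extVanishes_of_periodic {n : ℕ} (hn : ∀ (M : ModuleCat.{u} A) (i : ℕ), n < i →
    ExtVanishes A i M) {J I F N B : ModuleCat.{u} A} [Module.Projective A F]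
    {f : N →ₗ[A] F} {g : F →ₗ[A] J} (hfg : IsShortExact f g)
    {f' : I →ₗ[A] B} {g' : B →ₗ[A] J} (hfg' : IsShortExact f' g')
    (s : J →ₗ[A] N) (r : N →ₗ[A] J) (hrs : r ∘ₗ s = LinearMap.id)
    (s' : I →ₗ[A] N) (r' : N →ₗ[A] I) (hrs' : r' ∘ₗ s' = LinearMap.id)
    (i : ℕ) (hi : 1 ≤ i) : ExtVanishes A i B := by
  have hN : ∀ i, 1 ≤ i → ExtVanishes A (i + 1) J → ExtVanishes A i N := fun i hi h =>
    (extVanishes_of_projective F i hi).left hfg h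
  -- Descending induction on the degree: `k` bounds how far `i` lies below the range where `hn`
  -- applies.
  have hJ : ∀ k i, 1 ≤ i → n < i + k → ExtVanishes A i J := by
    intro k
    induction k with
    | zero => exact fun i _ h => hn J i h
    | succ k ih =>
      exact fun i hi h => (hN i hi (ih (i + 1) (by omega) (by omega))).of_retract s r hrs
  have hJ' : ∀ i, 1 ≤ i → ExtVanishes A i J := fun i hi => hJ (n + 1) i hi (by omega)
  exact ((hN i hi (hJ' (i + 1) (by omega))).of_retract s' r' hrs').middle hfg' (hJ' i hi)

end

/-! ### Change of rings along a map S → R -/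

section

variable {S R : Type u} [CommRing S] [CommRing R] (φ : S →+* R)

lemma IsShortExact.restrictScalars {M N P : ModuleCat.{u} R} {f : M →ₗ[R] N} {g : N →ₗ[R] P}
    (h : IsShortExact f g) :
    IsShortExact ((ModuleCat.restrictScalars φ).map (ModuleCat.ofHom f)).hom
      ((ModuleCat.restrictScalars φ).map (ModuleCat.ofHom g)).hom :=
  ⟨h.injective, h.exact, h.surjective⟩

variable {φ} {n : ℕ} (hn : ∀ (M : ModuleCat.{u} S) (i : ℕ), n < i → ExtVanishes S i M)
  (hP : ∀ (P : ModuleCat.{u} R) (i : ℕ), Module.Projective R P → 1 ≤ i →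
    ExtVanishes S i ((ModuleCat.restrictScalars φ).obj P))

include hn hP

/-- Coresolving to the right by projectives moves Ext^i(M) into ever higher degrees, until it passes
`n`. -/
lemma IsGorensteinProjective.extVanishes_restrictScalars {M : ModuleCat.{u} R}
    (hM : IsGorensteinProjective R M) (i : ℕ) (hi : 1 ≤ i) :
    ExtVanishes S i ((ModuleCat.restrictScalars φ).obj M) := by
  have key : ∀ k i, 1 ≤ i → n < i + k → ∀ M : ModuleCat.{u} R, IsGorensteinProjective R M →
      ExtVanishes S i ((ModuleCat.restrictScalars φ).obj M) := by
    intro k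
    induction k with
    | zero => exact fun i _ h M _ => hn _ i h
    | succ k ih =>
      intro i hi h M hM
      obtain ⟨N, hN, P, f, g, hPP, hfg, -⟩ := hM.exists_step_right
      exact (hP P i hPP hi).left (hfg.restrictScalars φ) (ih (i + 1) (by omega) (by omega) N hN)
  exact key (n + 1) i hi (by omega) M hM

lemma extVanishes_restrictScalars (m : ℕ) (M : ModuleCat.{u} R)
    (hM : HasGorensteinProjectiveResolution R m M) (i : ℕ) (hi : m < i) :
    ExtVanishes S i ((ModuleCat.restrictScalars φ).obj M) := by
  induction m generalizing M i with
  | zero => exact IsGorensteinProjective.extVanishes_restrictScalars hn hP (M := M) hM i hi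
  | succ m ih =>
    obtain ⟨G, _, _, p, hG, hp, hK⟩ := hM
    obtain ⟨i, rfl⟩ : ∃ j, i = j + 1 := ⟨i - 1, by omega⟩
    exact (ih (ModuleCat.of R (LinearMap.ker p)) hK i (by omega)).right
      ((isShortExact_ker hp).restrictScalars (M := ModuleCat.of R (LinearMap.ker p))
        (N := ModuleCat.of R G) φ)
      (IsGorensteinProjective.extVanishes_restrictScalars hn hP (M := ModuleCat.of R G) hG _
        (by omega))

omit hn hP

lemma extVanishes_of_restrictScalars {i : ℕ} (ψ : R →+* S) (hφψ : ∀ r, φ (ψ r) = r)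
    (hφ : ∀ s t, φ s = 0 → φ t = 0 → s * t = 0)
    (h : ∀ M : ModuleCat.{u} R, ExtVanishes S i ((ModuleCat.restrictScalars φ).obj M))
    (M : ModuleCat.{u} S) : ExtVanishes S i M := by
  -- A module killed by ker φ is the restriction along φ of its own restriction along ψ.
  have key : ∀ N : ModuleCat.{u} S, (∀ s, φ s = 0 → ∀ x : N, s • x = 0) → ExtVanishes S i N := by
    intro N hN
    refine (h ((ModuleCat.restrictScalars ψ).obj N)).of_equiv
      { toFun := fun x => x
        invFun := fun x => x
        map_add' := fun _ _ => rfl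
        map_smul' := fun s x => ?_
        left_inv := fun _ => rfl
        right_inv := fun _ => rfl }
    change s • x = ψ (φ s) • x
    have := hN (s - ψ (φ s)) (by rw [map_sub, hφψ, sub_self]) x
    rwa [sub_smul, sub_eq_zero] at this
  let L : Submodule S M := RingHom.ker φ • ⊤
  refine (key (ModuleCat.of S L) ?_).middle (isShortExact_mkQ L) (key (ModuleCat.of S (M ⧸ L)) ?_)
  · rintro s hs ⟨x, hx⟩
    refine Subtype.ext ?_
    change s • x = 0
    induction hx using Submodule.smul_induction_on' with
    | smul t ht y _ => rw [← mul_smul, hφ s t hs ht, zero_smul]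
    | add x _ y _ hx hy => rw [smul_add, hx, hy, add_zero]
  · intro s hs x
    obtain ⟨y, rfl⟩ := L.mkQ_surjective x
    exact (Submodule.Quotient.mk_eq_zero L).2 (Submodule.smul_mem_smul hs trivial)

end

/-! ### The ideals J and I of R ⋉ E -/

section

variable (R : Type u) [CommRing R] (E : Type u) [AddCommGroup E] [Module R E] [Module Rᵐᵒᵖ E]
  [IsCentralScalar R E]

open TrivSqZeroExt

/-- The projection `R ⋉ E → R`. -/
def TrivSqZeroExt.fstRingHom : TrivSqZeroExt R E →+* R := (fstHom R R E).toRingHom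

@[simp] lemma TrivSqZeroExt.fstRingHom_apply (s : TrivSqZeroExt R E) :
    fstRingHom R E s = s.fst := rfl

/-- The module `R` over `R ⋉ E`. -/
noncomputable abbrev TrivSqZeroExt.fstModule : ModuleCat.{u} (TrivSqZeroExt R E) :=
  (ModuleCat.restrictScalars (fstRingHom R E)).obj (ModuleCat.of R R)

variable {R E}

/-- The ideal of elements `(r, 0)` with `r` in the annihilator of a generator `e` of `E`. -/
def TrivSqZeroExt.annihilatorIdeal {e : E} (he : ∀ x : E, ∃ r : R, r • e = x) :
    Ideal (TrivSqZeroExt R E) where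
  carrier := {s | s.snd = 0 ∧ s.fst • e = 0}
  zero_mem' := by simp
  add_mem' := by
    rintro a b ⟨ha, ha'⟩ ⟨hb, hb'⟩
    simp [add_smul, ha, hb, ha', hb']
  smul_mem' := by
    rintro c a ⟨ha, ha'⟩
    -- Cyclicity makes this an ideal: an element killing `e` also kills `c.snd = t • e`, so no
    -- second component appears.
    obtain ⟨t, ht⟩ := he c.snd
    constructor
    · simp [ha, ← ht, smul_comm a.fst t e, ha']
    · simp [mul_smul, ha']

/-- Multiplication by `(0, e)`, with values in the ideal `0 ⋉ E`. -/
def TrivSqZeroExt.mulInr (e : E) :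
    TrivSqZeroExt R E →ₗ[TrivSqZeroExt R E] RingHom.ker (fstRingHom R E) :=
  LinearMap.codRestrict _ (LinearMap.mulRight (TrivSqZeroExt R E) (inr e)) (by
    intro s
    simp [RingHom.mem_ker])

lemma TrivSqZeroExt.coe_mulInr (e : E) (s : TrivSqZeroExt R E) :
    (mulInr e s : TrivSqZeroExt R E) = s * inr e := rfl

/-- The map `R → 0 ⋉ E` sending `r` to `(0, r e)`. -/
noncomputable def TrivSqZeroExt.smulInr (e : E) :
    fstModule R E →ₗ[TrivSqZeroExt R E] RingHom.ker (fstRingHom R E) where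
  toFun r := ⟨inr ((show R from r) • e), by simp [RingHom.mem_ker]⟩
  map_add' r r' := by
    ext <;> simp
    exact add_smul _ _ _
  map_smul' s r := by
    ext
    · simp
    · simp
      exact mul_smul _ _ _

/-- The map from the annihilator to `R`. -/
noncomputable def TrivSqZeroExt.annihilatorFst {e : E} (he : ∀ x : E, ∃ r : R, r • e = x) :
    annihilatorIdeal he →ₗ[TrivSqZeroExt R E] fstModule R E where
  toFun s := s.1.fst
  map_add' _ _ := rfl
  map_smul' _ _ := rfl

variable {e : E} (he : ∀ x : E, ∃ r : R, r • e = x)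

/-- Since (r, x)(0, e) = (0, re), the kernel is Ann(e) × E, which is J ⊕ I. -/
lemma TrivSqZeroExt.isShortExact_mulInr : IsShortExact
    (LinearMap.coprod (RingHom.ker (fstRingHom R E)).subtype (annihilatorIdeal he).subtype)
    (mulInr e) := by
  have hker : ∀ x : TrivSqZeroExt R E, mulInr e x = 0 ↔ x.fst • e = 0 := by
    intro x
    rw [Subtype.ext_iff, TrivSqZeroExt.ext_iff, coe_mulInr]
    simp
  refine ⟨(injective_iff_map_eq_zero _).2 ?_, ?_, ?_⟩
  · rintro ⟨⟨x, hx⟩, ⟨y, hy, hy'⟩⟩ h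
    have hx' : x.fst = 0 := hx
    have h : x + y = 0 := h
    have h1 : y = 0 := by
      refine TrivSqZeroExt.ext ?_ hy
      simpa [hx'] using congrArg fst h
    have h2 : x = 0 := by simpa [h1] using h
    subst h1 h2
    rfl
  · intro x
    rw [hker]
    constructor
    · intro hx
      refine ⟨(⟨inr x.snd, by simp [RingHom.mem_ker]⟩, ⟨inl x.fst, by simp, by simpa using hx⟩), ?_⟩
      ext <;> simp
    · rintro ⟨⟨⟨y, hy⟩, ⟨z, hz, hz'⟩⟩, rfl⟩
      have hy' : y.fst = 0 := hy
      simp [hy', hz']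
  · rintro ⟨y, hy⟩
    have hy' : y.fst = 0 := hy
    obtain ⟨r, hr⟩ := he y.snd
    refine ⟨inl r, Subtype.ext ?_⟩
    rw [coe_mulInr]
    ext <;> simp [hy', hr]

lemma TrivSqZeroExt.isShortExact_annihilatorFst :
    IsShortExact (annihilatorFst he) (smulInr e) := by
  refine ⟨?_, ?_, ?_⟩
  · rintro ⟨x, hx, hx'⟩ ⟨y, hy, hy'⟩ h
    exact Subtype.ext (TrivSqZeroExt.ext h (hx.trans hy.symm))
  · intro r
    rw [Subtype.ext_iff, TrivSqZeroExt.ext_iff]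
    constructor
    · rintro ⟨-, h⟩
      exact ⟨⟨inl (show R from r), rfl, h⟩, rfl⟩
    · rintro ⟨⟨x, hx, hx'⟩, rfl⟩
      exact ⟨rfl, hx'⟩
  · rintro ⟨y, hy⟩
    have hy' : y.fst = 0 := hy
    obtain ⟨r, hr⟩ := he y.snd
    refine ⟨r, Subtype.ext ?_⟩
    ext
    · exact hy'.symm
    · exact hr

include he in
-- A projective R-module P is a retract of the free module on its underlying set, so the periodicity
-- argument is run on the `P`-indexed direct sums of the two sequences.
lemma TrivSqZeroExt.extVanishes_restrictScalars_of_projective {n : ℕ}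
    (hn : ∀ (M : ModuleCat.{u} (TrivSqZeroExt R E)) (i : ℕ), n < i → ExtVanishes _ i M)
    (P : ModuleCat.{u} R) (i : ℕ) (hP : Module.Projective R P) (hi : 1 ≤ i) :
    ExtVanishes _ i ((ModuleCat.restrictScalars (fstRingHom R E)).obj P) := by
  let J := RingHom.ker (fstRingHom R E)
  let I := annihilatorIdeal he
  let T := TrivSqZeroExt R E
  have hF : Module.Projective T (ModuleCat.of T (P →₀ T)) :=
    inferInstanceAs (Module.Projective T (P →₀ T))
  have h1 : ExtVanishes T i (ModuleCat.of T (P →₀ fstModule R E)) :=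
    extVanishes_of_periodic hn (J := ModuleCat.of T (P →₀ J)) (I := ModuleCat.of T (P →₀ I))
      (N := ModuleCat.of T (P →₀ J × I)) (F := ModuleCat.of T (P →₀ T))
      ((isShortExact_mulInr he).finsupp P) ((isShortExact_annihilatorFst he).finsupp P)
      (Finsupp.mapRange.linearMap (LinearMap.inl T J I))
      (Finsupp.mapRange.linearMap (LinearMap.fst T J I))
      (by
        rw [← Finsupp.mapRange.linearMap_comp, LinearMap.fst_comp_inl,
          Finsupp.mapRange.linearMap_id])
      (Finsupp.mapRange.linearMap (LinearMap.inr T J I))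
      (Finsupp.mapRange.linearMap (LinearMap.snd T J I))
      (by
        rw [← Finsupp.mapRange.linearMap_comp, LinearMap.snd_comp_inr,
          Finsupp.mapRange.linearMap_id])
      i hi
  have h2 : ExtVanishes T i ((ModuleCat.restrictScalars (fstRingHom R E)).obj
      (ModuleCat.of R (P →₀ R))) :=
    h1.of_equiv
      { toFun := fun x => x
        invFun := fun x => x
        map_add' := fun _ _ => rfl
        map_smul' := fun s x => by ext; rfl
        left_inv := fun _ => rfl
        right_inv := fun _ => rfl }
  obtain ⟨σ, hσ⟩ := (Module.projective_def').1 hP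
  refine h2.of_retract ((ModuleCat.restrictScalars (fstRingHom R E)).map (ModuleCat.ofHom σ)).hom
    ((ModuleCat.restrictScalars (fstRingHom R E)).map
      (ModuleCat.ofHom (Finsupp.linearCombination R id))).hom ?_
  ext x
  exact LinearMap.congr_fun hσ x

end

/-! ### Conclusion -/

theorem mainTheorem4 (R : Type u) [CommRing R] (E : Type u) [AddCommGroup E]
    [Module R E] [Module Rᵐᵒᵖ E] [IsCentralScalar R E]
    [Nontrivial E] (hE : ∃ e : E, Submodule.span R {e} = ⊤)
    (hfin : Ggldim (TrivSqZeroExt R E) < ⊤) :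
    Ggldim (TrivSqZeroExt R E) ≤ Ggldim R := by
  obtain ⟨e, he⟩ := hE
  have he' : ∀ x : E, ∃ r : R, r • e = x := (Submodule.span_singleton_eq_top_iff R e).1 he
  obtain ⟨n, hn⟩ := ENat.ne_top_iff_exists.1 hfin.ne
  have hres := exists_hasGorensteinProjectiveResolution_of_Ggldim_le hn.ge
  have hn' : ∀ (M : ModuleCat.{u} (TrivSqZeroExt R E)) (i : ℕ), n < i → ExtVanishes _ i M := by
    intro M i hi
    obtain ⟨k, hk, hM⟩ := hres M
    exact extVanishes_of_hasGorensteinProjectiveResolution k M hM i (by omega)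
  by_cases hR : Ggldim R = ⊤
  · rw [hR]
    exact le_top
  obtain ⟨m, hm⟩ := ENat.ne_top_iff_exists.1 hR
  rw [← hm]
  refine iSup_le fun M => iInf₂_le m ?_
  refine hasGorensteinProjectiveResolution_of_extVanishes
    (fun M => (hres M).imp fun _ h => h.2) m M fun i hi => ?_
  refine extVanishes_of_restrictScalars (φ := TrivSqZeroExt.fstRingHom R E)
    (TrivSqZeroExt.inlHom R E) (fun r => rfl) (fun s t hs ht => ?_) (fun N => ?_) M
  · have hs' : s.fst = 0 := hs
    have ht' : t.fst = 0 := ht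
    ext <;> simp [hs', ht']
  · obtain ⟨k, hk, hN⟩ := exists_hasGorensteinProjectiveResolution_of_Ggldim_le hm.ge N
    exact extVanishes_restrictScalars hn'
      (TrivSqZeroExt.extVanishes_restrictScalars_of_projective he' hn') k N hN i (by omega)
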